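/- Let $M$ be a $C^\infty$ manifold (finite-dimensional, Hausdorff, second countable, without boundary) and let $F$ be a smooth foliation of $M$ with two-dimensional leaves which is orientable, i.e. the tangent planes of the leaves can be oriented continuously. A Poisson tensor on $M$ is a smooth bivector field $h=(h^{ij})$ whose bracket $\{f,g\}=h^{ij}\,\partial_i f\,\partial_j g$ on $C^\infty(M)$ satisfies the Jacobi identity; $F$ is called its Casimir foliation if at every point the tangent plane of the leaf of $F$ is the image of the map $h^\sharp:T^*M\to TM$, $\beta\mapsto h(\cdot,\beta)$. Then: 1. There is at least one Poisson tensor on $M$ whose Casimir foliation is $F$. 2. If $h_1,h_2$ are two Poisson tensors with Casimir foliation $F$, then there is a smooth function $f:M\to\mathbb R$ with $f(x)\neq 0$ for all $x\in M$ and $h_1^{ij}(x)=f(x)\,h_2^{ij}(x)$. Moreover, for every Hamiltonian, i.e. every closed $1$-form $\eta$ on $M$ (locally $\eta=dH$, in particular for every $H\in C^\infty(M)$), the Hamiltonian systems $X_1=h_1^\sharp\eta$ and $X_2=h_2^\sharp\eta$ differ only by a time change and have the same trajectories: for each integral curve $\gamma$ of $X_2$ on an open interval $J$ there are an open interval $J'$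 and a differentiable bijection $\theta:J'\to J$ with $\theta'(s)=f(\gamma(\theta(s)))$ such that $\gamma\circ\theta$ is an integral curve of $X_1$; the same holds with the roles of $X_1$ and $X_2$ exchanged and $f$ replaced by $1/f$; and through every point of $M$ the trajectories of $X_1$ and $X_2$ coincide as sets. -/

import Mathlib

open scoped Manifold ContDiff

/-- A smooth foliation with `k`-dimensional leaves on an `n`-dimensional manifold, given by the
tangent spaces of its leaves. It is integrable by definition: around every point there is a smooth
chart in which the leaves are the translates of one fixed `k`-dimensional linear subspace `L`. -/
structure Foliation (n k : ℕ) (M : Type*) [TopologicalSpace M]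
    [ChartedSpace (EuclideanSpace ℝ (Fin n)) M] where
  /-- the tangent space at `x` of the leaf through `x` -/
  tangent : ∀ x : M, Submodule ℝ (TangentSpace (𝓡 n) x)
  exists_foliated_chart : ∀ x : M, ∃ φ ∈ IsManifold.maximalAtlas (𝓡 n) ∞ M, x ∈ φ.source ∧
    ∃ L : Submodule ℝ (EuclideanSpace ℝ (Fin n)), Module.finrank ℝ L = k ∧
      ∀ y ∈ φ.source, ∀ v : TangentSpace (𝓡 n) y,
        v ∈ tangent y ↔ mvfderiv (𝓡 n) φ y v ∈ L

/-- A smooth bivector field `h = (hⁱʲ)`, as a field of alternating bilinear forms on the cotangent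
spaces. Smoothness is tested on differentials of smooth functions; applied to functions that agree
near a point with coordinates, it says that the components `hⁱʲ` in any chart are smooth. -/
structure BivectorField (n : ℕ) (M : Type*) [TopologicalSpace M]
    [ChartedSpace (EuclideanSpace ℝ (Fin n)) M] where
  form : ∀ x : M, Module.Dual ℝ (TangentSpace (𝓡 n) x) →ₗ[ℝ]
    Module.Dual ℝ (TangentSpace (𝓡 n) x) →ₗ[ℝ] ℝ
  alternating : ∀ (x : M) (α : Module.Dual ℝ (TangentSpace (𝓡 n) x)), form x α α = 0
  smooth : ∀ f g : C^∞⟮𝓡 n, M; ℝ⟯, ContMDiff (𝓡 n) 𝓘(ℝ, ℝ) ∞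
    (fun x => form x (mvfderiv (𝓡 n) f x).toLinearMap (mvfderiv (𝓡 n) g x).toLinearMap)

instance tangentSpaceFiniteDimensional {n : ℕ} {M : Type*} [TopologicalSpace M]
    [ChartedSpace (EuclideanSpace ℝ (Fin n)) M] (x : M) :
    FiniteDimensional ℝ (TangentSpace (𝓡 n) x) :=
  inferInstanceAs (FiniteDimensional ℝ (EuclideanSpace ℝ (Fin n)))

section

variable {n : ℕ} {M : Type*} [TopologicalSpace M] [ChartedSpace (EuclideanSpace ℝ (Fin n)) M]

/-- A foliation is orientable if the tangent spaces of its leaves can be oriented so that, around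
every point, the orientation is the one of a smooth frame of the tangent spaces of the leaves. -/
def Foliation.IsOrientable [IsManifold (𝓡 n) ∞ M] {k : ℕ} (F : Foliation n k M) : Prop :=
  ∃ o : ∀ x : M, Orientation ℝ (F.tangent x) (Fin k),
    ∀ x : M, ∃ U : Set M, IsOpen U ∧ x ∈ U ∧
      ∃ X : Fin k → ∀ y : M, TangentSpace (𝓡 n) y,
        (∀ i, ContMDiffOn (𝓡 n) (𝓡 n).tangent ∞
          (fun y => (⟨y, X i y⟩ : TangentBundle (𝓡 n) M)) U) ∧
        ∀ y ∈ U, ∃ b : Module.Basis (Fin k) ℝ (F.tangent y),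
          (∀ i, (b i : TangentSpace (𝓡 n) y) = X i y) ∧ b.orientation = o y

/-- The bracket `{f, g} = hⁱʲ ∂ᵢf ∂ⱼg`. -/
noncomputable def BivectorField.bracket (h : BivectorField n M) (f g : C^∞⟮𝓡 n, M; ℝ⟯) :
    C^∞⟮𝓡 n, M; ℝ⟯ :=
  ⟨fun x => h.form x (mvfderiv (𝓡 n) f x).toLinearMap (mvfderiv (𝓡 n) g x).toLinearMap,
    h.smooth f g⟩

/-- The tangent vector `h♯β` determined by `α (h♯β) = h (α, β)` for all covectors `α`. -/
noncomputable def BivectorField.sharp (h : BivectorField n M) (x : M) :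
    Module.Dual ℝ (TangentSpace (𝓡 n) x) →ₗ[ℝ] TangentSpace (𝓡 n) x :=
  (Module.evalEquiv ℝ (TangentSpace (𝓡 n) x)).symm.toLinearMap ∘ₗ (h.form x).flip

theorem BivectorField.apply_sharp (h : BivectorField n M) (x : M)
    (α β : Module.Dual ℝ (TangentSpace (𝓡 n) x)) : α (h.sharp x β) = h.form x α β := by
  simp [BivectorField.sharp]

/-- A 1-form is closed if locally it is the differential of a smooth function, that is, of a
Hamiltonian which is locally well defined modulo an additive constant. -/
def IsClosedOneForm (η : ∀ x : M, Module.Dual ℝ (TangentSpace (𝓡 n) x)) : Prop :=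
  ∀ x : M, ∃ U : Set M, IsOpen U ∧ x ∈ U ∧ ∃ H : M → ℝ,
    ContMDiffOn (𝓡 n) 𝓘(ℝ, ℝ) ∞ H U ∧ ∀ y ∈ U, η y = (mvfderiv (𝓡 n) H y).toLinearMap

/-- `X` is obtained from `Y` by the time change with rate `g`: after a reparametrization `θ` of
time with `θ' = g` along the curve, every integral curve of `Y` becomes an integral curve of `X`. -/
def IsTimeChangeOf (g : M → ℝ) (X Y : ∀ x : M, TangentSpace (𝓡 n) x) : Prop :=
  ∀ (γ : ℝ → M) (J : Set ℝ), IsOpen J → J.OrdConnected → IsMIntegralCurveOn γ Y J →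
    ∃ (θ : ℝ → ℝ) (J' : Set ℝ), IsOpen J' ∧ J'.OrdConnected ∧ Set.BijOn θ J' J ∧
      (∀ s ∈ J', HasDerivAt θ (g (γ (θ s))) s) ∧ IsMIntegralCurveOn (γ ∘ θ) X J'

/-- The trajectory of `X` through `x`: all points on integral curves of `X` passing through `x`. -/
def trajectory (X : ∀ x : M, TangentSpace (𝓡 n) x) (x : M) : Set M :=
  {y | ∃ (γ : ℝ → M) (J : Set ℝ), IsOpen J ∧ J.OrdConnected ∧ IsMIntegralCurveOn γ X J ∧
    x ∈ γ '' J ∧ y ∈ γ '' J}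

end

/-- A Poisson tensor: a smooth bivector field whose bracket satisfies the Jacobi identity.
(Skew symmetry and the Leibniz rule hold for the bracket of any bivector field.) -/
structure PoissonTensor (n : ℕ) (M : Type*) [TopologicalSpace M]
    [ChartedSpace (EuclideanSpace ℝ (Fin n)) M] extends BivectorField n M where
  jacobi : ∀ f g k : C^∞⟮𝓡 n, M; ℝ⟯,
    toBivectorField.bracket (toBivectorField.bracket f g) k
      + toBivectorField.bracket (toBivectorField.bracket g k) f
      + toBivectorField.bracket (toBivectorField.bracket k f) g = 0

section

variable {n : ℕ} {M : Type*} [TopologicalSpace M] [ChartedSpace (EuclideanSpace ℝ (Fin n)) M]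

/-- `F` is the Casimir (symplectic) foliation of `h`: the tangent spaces of the leaves of `F` are
spanned by the vectors `h♯β`. Equivalently, the covectors that vanish on the leaves of `F` are
those annihilated by `h`. -/
def PoissonTensor.HasCasimirFoliation {k : ℕ} (h : PoissonTensor n M) (F : Foliation n k M) :
    Prop :=
  ∀ x : M, LinearMap.range (h.sharp x) = F.tangent x

/-- The Hamiltonian vector field of a 1-form `η`; for `η = dH` it is the system
`df/dt = {f, H}`. -/
noncomputable def PoissonTensor.hamiltonianField (h : PoissonTensor n M)
    (η : ∀ x : M, Module.Dual ℝ (TangentSpace (𝓡 n) x)) (x : M) : TangentSpace (𝓡 n) x :=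
  h.sharp x (η x)

end

/-! A bivector whose `sharp` takes values in a plane `T` lies in the line `Λ²T`, so it is `c • (v ∧
w)` for a basis `v, w` of `T`, and its image is all of `T` exactly when `c ≠ 0`. Everything rests on
this line.

Existence: the bivectors `X₀ ∧ X₁` of oriented local frames differ on overlaps by positive
determinants, so a partition of unity glues them into a bivector field that vanishes nowhere
(`Foliation.IsOrientable.exists_bivectorField`). The Jacobi identity is then automatic: in a
foliated chart the bracket is `W (∂₀f ∂₁g - ∂₁f ∂₀g)` with constant, hence commuting, directions,
and in two directions any coefficient `W` is allowed (`planarBracket_jacobi`).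

Uniqueness: two nonzero elements of a line have a nonzero ratio `f`, which is smooth because locally
it is a quotient of brackets. Hence `X₁ = f X₂`, and the time change solves `θ' = f(γ(θ))` by
separation of variables (`exists_time_change`). -/

/-! ### Bivectors on a plane -/

section LinearAlgebra

variable {V : Type*} [AddCommGroup V] [Module ℝ V]

/-- The alternating bilinear form `v ∧ w` on the dual space. -/
def wedgeForm (v w : V) : Module.Dual ℝ V →ₗ[ℝ] Module.Dual ℝ V →ₗ[ℝ] ℝ :=
  LinearMap.mk₂ ℝ (fun α β => α v * β w - α w * β v)
    (fun _ _ _ => by simp; ring) (fun _ _ _ => by simp; ring)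
    (fun _ _ _ => by simp; ring) (fun _ _ _ => by simp; ring)

@[simp]
theorem wedgeForm_apply (v w : V) (α β : Module.Dual ℝ V) :
    wedgeForm v w α β = α v * β w - α w * β v := rfl

/-- An alternating form on the dual of `V` that is tangent to `T` is determined by its value on
two covectors which span the dual of `T`. -/
theorem alternating_apply_eq_of_eqOn {B : Module.Dual ℝ V →ₗ[ℝ] Module.Dual ℝ V →ₗ[ℝ] ℝ}
    (hB : ∀ α, B α α = 0) {T : Submodule ℝ V}
    (hT : ∀ α, (∀ v ∈ T, α v = 0) → ∀ β, B α β = 0)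
    {ξ₀ ξ₁ α β : Module.Dual ℝ V} {a₀ a₁ b₀ b₁ : ℝ}
    (hα : ∀ v ∈ T, α v = a₀ * ξ₀ v + a₁ * ξ₁ v) (hβ : ∀ v ∈ T, β v = b₀ * ξ₀ v + b₁ * ξ₁ v) :
    B α β = B ξ₀ ξ₁ * (a₀ * b₁ - a₁ * b₀) := by
  have hskew : ∀ α β, B α β = -B β α := fun α β => by
    have h := hB (α + β)
    simp only [map_add, LinearMap.add_apply, hB] at h
    linarith
  have h₁ : ∀ γ, B α γ = a₀ * B ξ₀ γ + a₁ * B ξ₁ γ := fun γ => by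
    have h := hT (α - (a₀ • ξ₀ + a₁ • ξ₁)) (fun v hv => by simp [hα v hv]) γ
    simp only [map_sub, map_add, map_smul, LinearMap.sub_apply, LinearMap.add_apply,
      LinearMap.smul_apply, smul_eq_mul] at h
    linarith
  have h₂ : ∀ γ, B β γ = b₀ * B ξ₀ γ + b₁ * B ξ₁ γ := fun γ => by
    have h := hT (β - (b₀ • ξ₀ + b₁ • ξ₁)) (fun v hv => by simp [hβ v hv]) γ
    simp only [map_sub, map_add, map_smul, LinearMap.sub_apply, LinearMap.add_apply,
      LinearMap.smul_apply, smul_eq_mul] at h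
    linarith
  rw [h₁, hskew ξ₀ β, hskew ξ₁ β, h₂, h₂, hB, hB, hskew ξ₁ ξ₀]
  ring

theorem wedgeForm_basis_eq_det_smul {T : Submodule ℝ V} (b b' : Module.Basis (Fin 2) ℝ T) :
    wedgeForm (b' 0 : V) (b' 1) = b.det b' • wedgeForm (b 0 : V) (b 1) := by
  have h : ∀ j, (b' j : V) = b.repr (b' j) 0 • (b 0 : V) + b.repr (b' j) 1 • (b 1 : V) :=
    fun j => by
      have hs := b.sum_repr (b' j)
      rw [Fin.sum_univ_two] at hs
      exact (congrArg Subtype.val hs).symm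
  ext α β
  rw [h 0, h 1]
  simp [Module.Basis.det_apply, Matrix.det_fin_two, Module.Basis.toMatrix_apply]
  ring

/-- Covectors on the whole space with the values of the dual basis of a basis of a subspace. -/
theorem exists_dual_basis_extension {T : Submodule ℝ V} (b : Module.Basis (Fin 2) ℝ T) :
    ∃ ξ₀ ξ₁ : Module.Dual ℝ V, ∀ v ∈ T, v = ξ₀ v • (b 0 : V) + ξ₁ v • (b 1 : V) := by
  obtain ⟨ξ₀, h₀⟩ := (b.coord 0).exists_extend
  obtain ⟨ξ₁, h₁⟩ := (b.coord 1).exists_extend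
  refine ⟨ξ₀, ξ₁, fun v hv => ?_⟩
  have e₀ : ξ₀ v = b.coord 0 ⟨v, hv⟩ := by rw [← h₀]; rfl
  have e₁ : ξ₁ v = b.coord 1 ⟨v, hv⟩ := by rw [← h₁]; rfl
  rw [e₀, e₁]
  have hs := b.sum_repr ⟨v, hv⟩
  rw [Fin.sum_univ_two] at hs
  exact (congrArg Subtype.val hs).symm

/-- The form descends to the dual of `T`, which is two-dimensional, and alternating forms there are
a line. -/
theorem exists_eq_smul_wedgeForm {B : Module.Dual ℝ V →ₗ[ℝ] Module.Dual ℝ V →ₗ[ℝ] ℝ}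
    (hB : ∀ α, B α α = 0) {T : Submodule ℝ V} (b : Module.Basis (Fin 2) ℝ T)
    (hT : ∀ α, (∀ v ∈ T, α v = 0) → ∀ β, B α β = 0) :
    ∃ c : ℝ, B = c • wedgeForm (b 0 : V) (b 1) := by
  obtain ⟨ξ₀, ξ₁, hξ⟩ := exists_dual_basis_extension b
  have key : ∀ (α : Module.Dual ℝ V), ∀ v ∈ T, α v = α (b 0) * ξ₀ v + α (b 1) * ξ₁ v :=
    fun α v hv => by
      conv_lhs => rw [hξ v hv]
      simp [mul_comm]
  refine ⟨B ξ₀ ξ₁, LinearMap.ext fun α => LinearMap.ext fun β => ?_⟩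
  rw [alternating_apply_eq_of_eqOn hB hT (key α) (key β)]
  simp

theorem exists_dual_apply_basis {T : Submodule ℝ V} (b : Module.Basis (Fin 2) ℝ T) (p q : ℝ) :
    ∃ β : Module.Dual ℝ V, β (b 0) = p ∧ β (b 1) = q := by
  obtain ⟨β, hβ⟩ := (b.constr ℝ ![p, q]).exists_extend
  refine ⟨β, ?_, ?_⟩
  · have := LinearMap.congr_fun hβ (b 0)
    simpa using this
  · have := LinearMap.congr_fun hβ (b 1)
    simpa using this

end LinearAlgebra

/-! ### The Jacobi identity in two constant directions -/

section FlatBracket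

variable {E : Type*} [NormedAddCommGroup E] [NormedSpace ℝ E]

/-- The bracket `W (∂₀f ∂₁g - ∂₁f ∂₀g)` with derivatives in the directions `e₀` and `e₁`. -/
noncomputable def planarBracket (W : E → ℝ) (e₀ e₁ : E) (f g : E → ℝ) (y : E) : ℝ :=
  W y * (fderiv ℝ f y e₀ * fderiv ℝ g y e₁ - fderiv ℝ f y e₁ * fderiv ℝ g y e₀)

theorem Filter.EventuallyEq.planarBracket {W : E → ℝ} {e₀ e₁ : E} {f f' g : E → ℝ} {y : E}
    (h : f =ᶠ[nhds y] f') : planarBracket W e₀ e₁ f g y = _root_.planarBracket W e₀ e₁ f' g y := by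
  simp only [_root_.planarBracket, h.fderiv_eq]

theorem fderiv_planarBracket {W f g : E → ℝ} {e₀ e₁ y : E} (hW : DifferentiableAt ℝ W y)
    (hf : DifferentiableAt ℝ (fderiv ℝ f) y) (hg : DifferentiableAt ℝ (fderiv ℝ g) y) (v : E) :
    fderiv ℝ (planarBracket W e₀ e₁ f g) y v =
      fderiv ℝ W y v * (fderiv ℝ f y e₀ * fderiv ℝ g y e₁ - fderiv ℝ f y e₁ * fderiv ℝ g y e₀)
      + W y * (fderiv ℝ (fderiv ℝ f) y v e₀ * fderiv ℝ g y e₁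
        + fderiv ℝ f y e₀ * fderiv ℝ (fderiv ℝ g) y v e₁
        - fderiv ℝ (fderiv ℝ f) y v e₁ * fderiv ℝ g y e₀
        - fderiv ℝ f y e₁ * fderiv ℝ (fderiv ℝ g) y v e₀) := by
  have hf' := fun e : E => hf.hasFDerivAt.clm_apply (hasFDerivAt_const e y)
  have hg' := fun e : E => hg.hasFDerivAt.clm_apply (hasFDerivAt_const e y)
  have h := hW.hasFDerivAt.mul (((hf' e₀).mul (hg' e₁)).sub ((hf' e₁).mul (hg' e₀)))
  have h' : fderiv ℝ (planarBracket W e₀ e₁ f g) y = _ := h.fderiv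
  rw [h']
  simp
  ring

/-- In the cyclic sum the terms with derivatives of `W` cancel algebraically; those with second
derivatives cancel once mixed derivatives are symmetric. -/
theorem planarBracket_jacobi {W f g k : E → ℝ} {e₀ e₁ y : E} (hW : DifferentiableAt ℝ W y)
    (hf : ContDiffAt ℝ 2 f y) (hg : ContDiffAt ℝ 2 g y) (hk : ContDiffAt ℝ 2 k y) :
    planarBracket W e₀ e₁ (planarBracket W e₀ e₁ f g) k y
      + planarBracket W e₀ e₁ (planarBracket W e₀ e₁ g k) f y
      + planarBracket W e₀ e₁ (planarBracket W e₀ e₁ k f) g y = 0 := by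
  have hd : ∀ {u : E → ℝ}, ContDiffAt ℝ 2 u y → DifferentiableAt ℝ (fderiv ℝ u) y := fun hu =>
    (hu.fderiv_right (m := 1) (by norm_num)).differentiableAt one_ne_zero
  have hs : ∀ {u : E → ℝ}, ContDiffAt ℝ 2 u y →
      fderiv ℝ (fderiv ℝ u) y e₁ e₀ = fderiv ℝ (fderiv ℝ u) y e₀ e₁ := fun hu =>
    (hu.isSymmSndFDerivAt (by simp)) e₁ e₀
  -- Only the outer bracket is unfolded, so that `fderiv_planarBracket` still recognises the inner
  -- one.
  simp only [planarBracket.eq_1 W e₀ e₁ (planarBracket W e₀ e₁ _ _),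
    fderiv_planarBracket hW (hd hf) (hd hg), fderiv_planarBracket hW (hd hg) (hd hk),
    fderiv_planarBracket hW (hd hk) (hd hf), hs hf, hs hg, hs hk]
  ring

end FlatBracket

/-! ### Reparametrization of time -/

/-- The autonomous equation `θ' = r(θ)` on an interval where `r` does not vanish has a solution
that runs through the whole interval. -/
theorem exists_time_change {J : Set ℝ} (hJ : IsOpen J) (hJc : J.OrdConnected) {r : ℝ → ℝ}
    (hr : ContinuousOn r J) (h0 : ∀ t ∈ J, r t ≠ 0) :
    ∃ (θ : ℝ → ℝ) (J' : Set ℝ), IsOpen J' ∧ J'.OrdConnected ∧ Set.BijOn θ J' J ∧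
      ∀ s ∈ J', HasDerivAt θ (r (θ s)) s := by
  rcases J.eq_empty_or_nonempty with rfl | ⟨t₀, ht₀⟩
  · exact ⟨id, ∅, isOpen_empty, Set.ordConnected_empty, Set.bijOn_empty _, by simp⟩
  have hri : ContinuousOn (fun t => (r t)⁻¹) J := hr.inv₀ h0
  -- Separation of variables: `G` is the new time as a function of the old one, and `θ` is its
  -- inverse.
  set G : ℝ → ℝ := fun t => ∫ u in t₀..t, (r u)⁻¹ with hG
  have hGd : ∀ t ∈ J, HasStrictDerivAt G (r t)⁻¹ t := fun t ht =>
    intervalIntegral.integral_hasStrictDerivAt_right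
      ((hri.mono (hJc.uIcc_subset ht₀ ht)).intervalIntegrable)
      (hri.stronglyMeasurableAtFilter hJ t ht) (hri.continuousAt (hJ.mem_nhds ht))
  have hGc : ContinuousOn G J := fun t ht => (hGd t ht).hasDerivAt.continuousAt.continuousWithinAt
  have hlt : ∀ a ∈ J, ∀ b ∈ J, a < b → G a ≠ G b := by
    intro a ha b hb hab he
    have hsub : Set.Icc a b ⊆ J := hJc.out ha hb
    obtain ⟨c, hc, hc0⟩ := exists_hasDerivAt_eq_zero hab (hGc.mono hsub) he
      (fun x hx => (hGd x (hsub (Set.Ioo_subset_Icc_self hx))).hasDerivAt)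
    exact inv_ne_zero (h0 c (hsub (Set.Ioo_subset_Icc_self hc))) hc0
  have hinj : Set.InjOn G J := by
    intro a ha b hb he
    rcases lt_trichotomy a b with h | h | h
    · exact absurd he (hlt a ha b hb h)
    · exact h
    · exact absurd he.symm (hlt b hb a ha h)
  have hleft : ∀ t ∈ J, Function.invFunOn G J (G t) = t := fun t ht => hinj.leftInvOn_invFunOn ht
  refine ⟨Function.invFunOn G J, G '' J, ?_, ?_, ?_, ?_⟩
  · rw [isOpen_iff_mem_nhds]
    rintro _ ⟨t, ht, rfl⟩
    -- A nonzero strict derivative makes `G` a local homeomorphism, so its image is open.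
    rw [← (hGd t ht).map_nhds_eq (inv_ne_zero (h0 t ht))]
    exact Filter.image_mem_map (hJ.mem_nhds ht)
  · exact (hJc.isPreconnected.image G hGc).ordConnected
  · refine ⟨?_, ?_, ?_⟩
    · rintro _ ⟨t, ht, rfl⟩
      rwa [hleft t ht]
    · rintro _ ⟨t, ht, rfl⟩ _ ⟨t', ht', rfl⟩ h
      rw [hleft t ht, hleft t' ht'] at h
      rw [h]
    · exact fun t ht => ⟨G t, ⟨t, ht, rfl⟩, hleft t ht⟩
  · rintro _ ⟨t, ht, rfl⟩
    have h := (hGd t ht).to_local_left_inverse (inv_ne_zero (h0 t ht))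
      (Filter.eventually_of_mem (hJ.mem_nhds ht) hleft)
    rw [hleft t ht]
    simpa using h.hasDerivAt

open Set Filter Topology

/-! ### Differentials and charts -/

section

variable {n : ℕ} {M : Type*} [TopologicalSpace M] [ChartedSpace (EuclideanSpace ℝ (Fin n)) M]

theorem mvfderiv_eq_of_eventuallyEq {f g : M → ℝ} {x : M} (h : f =ᶠ[𝓝 x] g) :
    mvfderiv (𝓡 n) f x = mvfderiv (𝓡 n) g x := by
  ext v
  have := h.mfderiv_eq (I := 𝓡 n) (I' := 𝓘(ℝ, ℝ))
  simp only [mvfderiv, ContinuousLinearMap.comp_apply]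
  rw [this]
  rfl

/-- The germ of a locally defined smooth function is the germ of a global one. -/
theorem exists_contMDiffMap_eventuallyEq [T2Space M] [IsManifold (𝓡 n) ∞ M] {f : M → ℝ}
    {U : Set M} (hU : IsOpen U) {x : M} (hx : x ∈ U) (hf : ContMDiffOn (𝓡 n) 𝓘(ℝ, ℝ) ∞ f U) :
    ∃ g : C^∞⟮𝓡 n, M; ℝ⟯, g =ᶠ[𝓝 x] f := by
  obtain ⟨b, -, hb⟩ := (SmoothBumpFunction.nhds_basis_tsupport (I := 𝓡 n) x).mem_iff.1
    (hU.mem_nhds hx)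
  refine ⟨⟨fun y => b y • f y, contMDiff_of_tsupport fun y hy => ?_⟩, ?_⟩
  · have hy' : y ∈ U := hb (tsupport_smul_subset_left _ _ hy)
    exact b.contMDiffAt.smul (hf.contMDiffAt (hU.mem_nhds hy'))
  · filter_upwards [b.eventuallyEq_one] with y hy
    simp [hy]

theorem contMDiffOn_mvfderiv_apply [IsManifold (𝓡 n) ∞ M] (f : C^∞⟮𝓡 n, M; ℝ⟯) {U : Set M}
    {X : ∀ y : M, TangentSpace (𝓡 n) y}
    (hX : ContMDiffOn (𝓡 n) (𝓡 n).tangent ∞ (fun y => (⟨y, X y⟩ : TangentBundle (𝓡 n) M)) U) :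
    ContMDiffOn (𝓡 n) 𝓘(ℝ, ℝ) ∞ (fun y => mvfderiv (𝓡 n) f y (X y)) U :=
  (contMDiff_snd_tangentBundle_modelSpace ℝ 𝓘(ℝ, ℝ)).comp_contMDiffOn
    ((f.contMDiff.contMDiff_tangentMap (m := ∞) le_rfl).comp_contMDiffOn hX)

section Chart

variable {φ : OpenPartialHomeomorph M (EuclideanSpace ℝ (Fin n))}

theorem mvfderiv_eq_fderiv_chart [IsManifold (𝓡 n) ∞ M]
    (hφ : φ ∈ IsManifold.maximalAtlas (𝓡 n) ∞ M) (f : C^∞⟮𝓡 n, M; ℝ⟯) {y : M}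
    (hy : y ∈ φ.source) (v : TangentSpace (𝓡 n) y) :
    mvfderiv (𝓡 n) f y v = fderiv ℝ (f ∘ φ.symm) (φ y) (mvfderiv (𝓡 n) φ y v) := by
  have h1 : MDifferentiableAt (𝓡 n) 𝓘(ℝ, ℝ) (f ∘ φ.symm) (φ y) := by
    refine ContMDiffAt.mdifferentiableAt (n := ∞) ?_ (by simp)
    exact f.contMDiff.contMDiffAt.comp _ (contMDiffAt_symm_of_mem_maximalAtlas hφ (φ.map_source hy))
  have h2 : MDifferentiableAt (𝓡 n) (𝓡 n) φ y :=
    (contMDiffAt_of_mem_maximalAtlas hφ hy).mdifferentiableAt (by simp)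
  have h3 : f =ᶠ[𝓝 y] (f ∘ φ.symm) ∘ φ := by
    filter_upwards [φ.open_source.mem_nhds hy] with z hz
    simp [φ.left_inv hz]
  rw [mvfderiv_eq_of_eventuallyEq h3, mvfderiv_comp_apply y h1 h2]
  simp only [mvfderiv, mfderiv_eq_fderiv]
  rfl

theorem contDiffAt_comp_chart_symm (hφ : φ ∈ IsManifold.maximalAtlas (𝓡 n) ∞ M)
    (f : C^∞⟮𝓡 n, M; ℝ⟯) {y : M} (hy : y ∈ φ.source) : ContDiffAt ℝ ∞ (f ∘ φ.symm) (φ y) := by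
  rw [← contMDiffAt_iff_contDiffAt]
  exact f.contMDiff.contMDiffAt.comp _ (contMDiffAt_symm_of_mem_maximalAtlas hφ (φ.map_source hy))

/-- Linear coordinates in a chart are, near a given point, global smooth functions. -/
theorem exists_contMDiffMap_coordinate [T2Space M] [IsManifold (𝓡 n) ∞ M]
    (hφ : φ ∈ IsManifold.maximalAtlas (𝓡 n) ∞ M) {x : M} (hx : x ∈ φ.source)
    (ξ : Module.Dual ℝ (EuclideanSpace ℝ (Fin n))) :
    ∃ u : C^∞⟮𝓡 n, M; ℝ⟯, ∀ᶠ y in 𝓝 x, ∀ v : TangentSpace (𝓡 n) y,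
      mvfderiv (𝓡 n) u y v = ξ (mvfderiv (𝓡 n) φ y v) := by
  obtain ⟨u, hu⟩ := exists_contMDiffMap_eventuallyEq φ.open_source hx
    (f := fun y => ξ.toContinuousLinearMap (φ y))
    (ξ.toContinuousLinearMap.contDiff.contMDiff.comp_contMDiffOn
      (contMDiffOn_of_mem_maximalAtlas hφ))
  refine ⟨u, ?_⟩
  filter_upwards [hu.eventually_nhds, φ.open_source.mem_nhds hx] with y hy hys v
  rw [mvfderiv_eq_fderiv_chart hφ u hys]
  have h : u ∘ φ.symm =ᶠ[𝓝 (φ y)] ξ.toContinuousLinearMap := by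
    have ht : Tendsto φ.symm (𝓝 (φ y)) (𝓝 y) := φ.tendsto_symm hys
    filter_upwards [ht.eventually hy, φ.open_target.mem_nhds (φ.map_source hys)] with z hz hzt
    simp only [Function.comp_apply]
    rw [hz, φ.right_inv hzt]
  rw [h.fderiv_eq, ContinuousLinearMap.fderiv]
  rfl

end Chart

/-- Every covector is the differential of a global smooth function. -/
theorem exists_contMDiffMap_mvfderiv_eq [T2Space M] [IsManifold (𝓡 n) ∞ M] (x : M)
    (α : Module.Dual ℝ (TangentSpace (𝓡 n) x)) :
    ∃ u : C^∞⟮𝓡 n, M; ℝ⟯, (mvfderiv (𝓡 n) u x).toLinearMap = α := by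
  set φ := chartAt (EuclideanSpace ℝ (Fin n)) x
  have hφ : φ ∈ IsManifold.maximalAtlas (𝓡 n) ∞ M := IsManifold.chart_mem_maximalAtlas x
  have hx : x ∈ φ.source := mem_chart_source _ x
  have hm : φ.MDifferentiable (𝓡 n) (𝓡 n) :=
    ⟨(contMDiffOn_of_mem_maximalAtlas hφ).mdifferentiableOn (by simp),
      (contMDiffOn_symm_of_mem_maximalAtlas hφ).mdifferentiableOn (by simp)⟩
  have hinj : Function.Injective (mfderiv (𝓡 n) (𝓡 n) φ x) := hm.mfderiv_injective hx
  set A : TangentSpace (𝓡 n) x →ₗ[ℝ] EuclideanSpace ℝ (Fin n) :=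
    (mvfderiv (𝓡 n) φ x).toLinearMap with hA
  obtain ⟨g, hg⟩ := A.exists_leftInverse_of_injective (LinearMap.ker_eq_bot.2 hinj)
  -- Since `g` inverts `dφ` from the left, `α ∘ g ∘ dφ = α`.
  obtain ⟨u, hu⟩ := exists_contMDiffMap_coordinate hφ hx (α ∘ₗ g)
  refine ⟨u, LinearMap.ext fun v => ?_⟩
  have h1 := hu.self_of_nhds v
  have h2 := LinearMap.congr_fun hg v
  simp only [LinearMap.comp_apply, LinearMap.id_apply] at h1 h2
  exact h1.trans (congrArg α h2)

/-! ### Bivector fields tangent to the leaves -/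

namespace BivectorField

theorem form_apply_eq_zero {k : ℕ} {F : Foliation n k M} (h : BivectorField n M) {x : M}
    (hT : LinearMap.range (h.sharp x) ≤ F.tangent x)
    (α : Module.Dual ℝ (TangentSpace (𝓡 n) x)) (hα : ∀ v ∈ F.tangent x, α v = 0)
    (β : Module.Dual ℝ (TangentSpace (𝓡 n) x)) : h.form x α β = 0 := by
  rw [← h.apply_sharp]
  exact hα _ (hT (LinearMap.mem_range_self _ β))

/-- A bivector field that is tangent to a foliation with two-dimensional leaves satisfies the
Jacobi identity. -/
theorem jacobi_of_range_sharp_le [T2Space M] [IsManifold (𝓡 n) ∞ M] {F : Foliation n 2 M}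
    (h : BivectorField n M) (hT : ∀ x, LinearMap.range (h.sharp x) ≤ F.tangent x)
    (f g k : C^∞⟮𝓡 n, M; ℝ⟯) :
    h.bracket (h.bracket f g) k + h.bracket (h.bracket g k) f + h.bracket (h.bracket k f) g
      = 0 := by
  ext x
  -- Integrability enters here: one plane `L` serves the whole chart, so its basis gives constant
  -- directions.
  obtain ⟨φ, hφ, hx, L, hL, hFL⟩ := F.exists_foliated_chart x
  let b : Module.Basis (Fin 2) ℝ L := Module.finBasisOfFinrankEq ℝ L hL
  obtain ⟨ξ₀, ξ₁, hξ⟩ := exists_dual_basis_extension b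
  obtain ⟨u₀, hu₀⟩ := exists_contMDiffMap_coordinate hφ hx ξ₀
  obtain ⟨u₁, hu₁⟩ := exists_contMDiffMap_coordinate hφ hx ξ₁
  set W := h.bracket u₀ u₁ ∘ φ.symm with hW
  -- The formula is needed near `x`, not only at `x`, because the outer bracket differentiates the
  -- inner one.
  have hloc : ∀ p q : C^∞⟮𝓡 n, M; ℝ⟯, ∀ᶠ y in 𝓝 x, h.bracket p q y =
      planarBracket W (b 0 : EuclideanSpace ℝ (Fin n)) (b 1) (p ∘ φ.symm) (q ∘ φ.symm) (φ y) := by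
    intro p q
    filter_upwards [hu₀, hu₁, φ.open_source.mem_nhds hx] with y h₀ h₁ hy
    have hd : ∀ r : C^∞⟮𝓡 n, M; ℝ⟯, ∀ v ∈ F.tangent y, (mvfderiv (𝓡 n) r y).toLinearMap v =
        fderiv ℝ (r ∘ φ.symm) (φ y) (b 0 : EuclideanSpace ℝ (Fin n))
            * (mvfderiv (𝓡 n) u₀ y).toLinearMap v
          + fderiv ℝ (r ∘ φ.symm) (φ y) (b 1 : EuclideanSpace ℝ (Fin n))
            * (mvfderiv (𝓡 n) u₁ y).toLinearMap v := by
      intro r v hv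
      simp only [ContinuousLinearMap.coe_coe]
      rw [h₀ v, h₁ v, mvfderiv_eq_fderiv_chart hφ r hy]
      conv_lhs => rw [hξ _ ((hFL y hy v).1 hv)]
      simp only [map_add, map_smul, smul_eq_mul]
      ring
    have := alternating_apply_eq_of_eqOn (h.alternating y) (h.form_apply_eq_zero (hT y))
      (hd p) (hd q)
    simpa [planarBracket, hW, φ.left_inv hy] using! this
  have hcomp : ∀ p q : C^∞⟮𝓡 n, M; ℝ⟯, h.bracket p q ∘ φ.symm =ᶠ[𝓝 (φ x)]
      planarBracket W (b 0 : EuclideanSpace ℝ (Fin n)) (b 1) (p ∘ φ.symm) (q ∘ φ.symm) := by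
    intro p q
    filter_upwards [(φ.tendsto_symm hx).eventually (hloc p q),
      φ.open_target.mem_nhds (φ.map_source hx)] with z hz hzt
    rw [Function.comp_apply, hz, φ.right_inv hzt]
  have htwice : ∀ p q r : C^∞⟮𝓡 n, M; ℝ⟯, h.bracket (h.bracket p q) r x =
      planarBracket W (b 0 : EuclideanSpace ℝ (Fin n)) (b 1)
        (planarBracket W (b 0 : EuclideanSpace ℝ (Fin n)) (b 1) (p ∘ φ.symm) (q ∘ φ.symm))
        (r ∘ φ.symm) (φ x) := fun p q r => by
    rw [(hloc (h.bracket p q) r).self_of_nhds, (hcomp p q).planarBracket]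
  have hsm : ∀ p : C^∞⟮𝓡 n, M; ℝ⟯, ContDiffAt ℝ 2 (p ∘ φ.symm) (φ x) := fun p =>
    (contDiffAt_comp_chart_symm hφ p hx).of_le (WithTop.coe_le_coe.2 le_top)
  simp only [ContMDiffMap.coe_add, Pi.add_apply, htwice]
  exact planarBracket_jacobi ((hsm _).differentiableAt two_ne_zero) (hsm f) (hsm g) (hsm k)

theorem range_sharp_eq {T : ∀ x : M, Submodule ℝ (TangentSpace (𝓡 n) x)} (h : BivectorField n M)
    {x : M} (b : Module.Basis (Fin 2) ℝ (T x)) {c : ℝ} (hc : c ≠ 0)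
    (hb : h.form x = c • wedgeForm (b 0 : TangentSpace (𝓡 n) x) (b 1)) :
    LinearMap.range (h.sharp x) = T x := by
  have hs : ∀ β, h.sharp x β =
      (c * β (b 1)) • (b 0 : TangentSpace (𝓡 n) x) - (c * β (b 0)) • (b 1 : TangentSpace (𝓡 n) x) :=
    fun β => by
      rw [← sub_eq_zero]
      refine (Module.forall_dual_apply_eq_zero_iff ℝ _).1 fun α => ?_
      rw [map_sub, h.apply_sharp, hb]
      simp
      ring
  refine le_antisymm ?_ fun v hv => ?_
  · rintro _ ⟨β, rfl⟩
    rw [hs]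
    exact sub_mem (Submodule.smul_mem _ _ (b 0).2) (Submodule.smul_mem _ _ (b 1).2)
  -- These values of `β` solve `c β(b₁) b₀ - c β(b₀) b₁ = v`.
  · obtain ⟨β, h₀, h₁⟩ := exists_dual_apply_basis b (-(c⁻¹ * b.repr ⟨v, hv⟩ 1))
      (c⁻¹ * b.repr ⟨v, hv⟩ 0)
    refine ⟨β, ?_⟩
    have hs' := b.sum_repr ⟨v, hv⟩
    rw [Fin.sum_univ_two] at hs'
    have hv' : b.repr ⟨v, hv⟩ 0 • (b 0 : TangentSpace (𝓡 n) x)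
      + b.repr ⟨v, hv⟩ 1 • (b 1 : TangentSpace (𝓡 n) x) = v := congrArg Subtype.val hs'
    rw [hs, h₀, h₁, mul_neg, mul_inv_cancel_left₀ hc, mul_inv_cancel_left₀ hc, neg_smul,
      sub_neg_eq_add, hv']

end BivectorField

end

/-! ### Existence by gluing oriented frames -/

section

variable {n : ℕ} {M : Type*} [TopologicalSpace M] [ChartedSpace (EuclideanSpace ℝ (Fin n)) M]

theorem Foliation.IsOrientable.exists_bivectorField [T2Space M] [SecondCountableTopology M]
    [IsManifold (𝓡 n) ∞ M] {F : Foliation n 2 M} (hF : F.IsOrientable) :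
    ∃ h : BivectorField n M, ∀ x, LinearMap.range (h.sharp x) = F.tangent x := by
  have : LocallyCompactSpace M := Manifold.locallyCompact_of_finiteDimensional (𝓡 n)
  obtain ⟨o, ho⟩ := hF
  choose U hUo hxU X hX b hbX hbo using ho
  obtain ⟨ρ, hρ⟩ := SmoothPartitionOfUnity.exists_isSubordinate (𝓡 n) (isClosed_univ (X := M)) U
    hUo (fun x _ => mem_iUnion.2 ⟨x, hxU x⟩)
  let h : BivectorField n M :=
    { form := fun x => ∑ i ∈ ρ.finsupport x, ρ i x • wedgeForm (X i 0 x) (X i 1 x)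
      alternating := fun x α => by
        simp only [LinearMap.sum_apply, LinearMap.smul_apply, wedgeForm_apply]
        exact Finset.sum_eq_zero fun i _ => by rw [mul_comm (α (X i 0 x)), sub_self, smul_zero]
      smooth := fun f g => by
        let φ : M → M → ℝ := fun i x =>
          mvfderiv (𝓡 n) f x (X i 0 x) * mvfderiv (𝓡 n) g x (X i 1 x)
            - mvfderiv (𝓡 n) f x (X i 1 x) * mvfderiv (𝓡 n) g x (X i 0 x)
        have hφ : ∀ i, ContMDiffOn (𝓡 n) 𝓘(ℝ, ℝ) ∞ (φ i) (U i) := fun i =>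
          ((contMDiffOn_mvfderiv_apply f (hX i 0)).mul
            (contMDiffOn_mvfderiv_apply g (hX i 1))).sub
          ((contMDiffOn_mvfderiv_apply f (hX i 1)).mul
            (contMDiffOn_mvfderiv_apply g (hX i 0)))
        refine (hρ.contMDiff_finsum_smul (n := (⊤ : ℕ∞)) hUo hφ).congr fun x => ?_
        rw [← ρ.sum_finsupport_smul_eq_finsum x φ]
        simp only [LinearMap.sum_apply, LinearMap.smul_apply, wedgeForm_apply]
        rfl }
  refine ⟨h, fun x => ?_⟩
  have hmem : ∀ i ∈ ρ.finsupport x, x ∈ U i := fun i hi =>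
    hρ i (subset_tsupport _ ((ρ.mem_finsupport x).1 hi))
  -- All frames at `x` are compared with the one from the neighbourhood chosen for `x` itself; equal
  -- orientations give positive determinants, so nothing cancels in the sum.
  let b₀ := b x x (hxU x)
  have hdet : ∀ i ∈ ρ.finsupport x, ∃ d : ℝ, 0 < d ∧
      wedgeForm (X i 0 x) (X i 1 x) = d • wedgeForm (b₀ 0 : TangentSpace (𝓡 n) x) (b₀ 1) := by
    intro i hi
    refine ⟨b₀.det (b i x (hmem i hi)), ?_, ?_⟩
    · rw [← Module.Basis.orientation_eq_iff_det_pos, hbo i x (hmem i hi), hbo x x (hxU x)]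
    · rw [← wedgeForm_basis_eq_det_smul, hbX, hbX]
  choose! d hd hwedge using hdet
  refine h.range_sharp_eq b₀ (c := ∑ i ∈ ρ.finsupport x, ρ i x * d i) (ne_of_gt ?_) ?_
  · refine Finset.sum_pos (fun i hi => mul_pos ?_ (hd i hi)) ?_
    · exact lt_of_le_of_ne (ρ.nonneg i x) (Ne.symm ((ρ.mem_finsupport x).1 hi))
    · obtain ⟨i, hi⟩ := ρ.exists_pos_of_mem (mem_univ x)
      exact ⟨i, (ρ.mem_finsupport x).2 hi.ne'⟩
  · rw [Finset.sum_smul]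
    exact Finset.sum_congr rfl fun i hi => by rw [hwedge i hi, smul_smul]

/-! ### Uniqueness up to a factor -/

namespace PoissonTensor

theorem HasCasimirFoliation.form_eq_smul_wedgeForm {F : Foliation n 2 M} {h : PoissonTensor n M}
    (hF : h.HasCasimirFoliation F) {x : M} (b : Module.Basis (Fin 2) ℝ (F.tangent x)) :
    ∃ c : ℝ, c ≠ 0 ∧ h.form x = c • wedgeForm (b 0 : TangentSpace (𝓡 n) x) (b 1) := by
  obtain ⟨c, hc⟩ := exists_eq_smul_wedgeForm (h.alternating x) b
    (h.toBivectorField.form_apply_eq_zero (hF x).le)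
  refine ⟨c, ?_, hc⟩
  rintro rfl
  have hzero : h.sharp x = 0 := by
    refine LinearMap.ext fun β => (Module.forall_dual_apply_eq_zero_iff ℝ _).1 fun α => ?_
    rw [h.apply_sharp, hc]
    simp
  obtain ⟨β, hβ⟩ := (hF x).ge (b 0).2
  rw [hzero] at hβ
  exact b.ne_zero 0 (Subtype.ext hβ.symm)

/-- Two Poisson tensors with the same orientable Casimir foliation with two-dimensional leaves
differ by a smooth nowhere vanishing factor. -/
theorem HasCasimirFoliation.exists_form_eq_smul [T2Space M] [IsManifold (𝓡 n) ∞ M]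
    {F : Foliation n 2 M} (hO : F.IsOrientable) {h₁ h₂ : PoissonTensor n M}
    (hF₁ : h₁.HasCasimirFoliation F) (hF₂ : h₂.HasCasimirFoliation F) :
    ∃ f : C^∞⟮𝓡 n, M; ℝ⟯, (∀ x, f x ≠ 0) ∧ ∀ x, h₁.form x = f x • h₂.form x := by
  have hpt : ∀ x, ∃ c : ℝ, c ≠ 0 ∧ h₁.form x = c • h₂.form x ∧ ∃ α β, h₂.form x α β ≠ 0 := by
    intro x
    obtain ⟨o, ho⟩ := hO
    obtain ⟨U, -, hxU, X, -, hb⟩ := ho x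
    obtain ⟨b, -, -⟩ := hb x hxU
    obtain ⟨c₁, h1, e₁⟩ := hF₁.form_eq_smul_wedgeForm b
    obtain ⟨c₂, h2, e₂⟩ := hF₂.form_eq_smul_wedgeForm b
    obtain ⟨α, hα₀, hα₁⟩ := exists_dual_apply_basis b 1 0
    obtain ⟨β, hβ₀, hβ₁⟩ := exists_dual_apply_basis b 0 1
    refine ⟨c₁ / c₂, div_ne_zero h1 h2, ?_, α, β, ?_⟩
    · rw [e₁, e₂, smul_smul, div_mul_cancel₀ _ h2]
    · rw [e₂]
      simp [hα₀, hα₁, hβ₀, hβ₁, h2]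
  choose f hf0 hf hne using hpt
  refine ⟨⟨f, fun x => ?_⟩, hf0, hf⟩
  obtain ⟨α, β, hαβ⟩ := hne x
  -- With `α = du` and `β = dv` at `x`, the factor is near `x` the quotient of the two brackets of
  -- `u` and `v`.
  obtain ⟨u, rfl⟩ := exists_contMDiffMap_mvfderiv_eq x α
  obtain ⟨v, rfl⟩ := exists_contMDiffMap_mvfderiv_eq x β
  have hs₁ := (h₁.smooth u v).contMDiffAt (x := x)
  have hs₂ := (h₂.smooth u v).contMDiffAt (x := x)
  refine (hs₁.div₀ hs₂ hαβ).congr_of_eventuallyEq ?_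
  filter_upwards [hs₂.continuousAt.eventually_ne hαβ] with y hy
  simp only [Pi.div_apply, hf y, LinearMap.smul_apply, smul_eq_mul]
  rw [mul_div_cancel_right₀ _ hy]

end PoissonTensor

/-! ### Proportional vector fields and their trajectories -/

theorem isTimeChangeOf_of_eq_smul {g : M → ℝ} (hg : Continuous g) (hg0 : ∀ x, g x ≠ 0)
    {X Y : ∀ x : M, TangentSpace (𝓡 n) x} (hXY : ∀ x, X x = g x • Y x) :
    IsTimeChangeOf g X Y := by
  intro γ J hJ hJc hγ
  obtain ⟨θ, J', hJ', hJc', hbij, hθ⟩ := exists_time_change hJ hJc (r := g ∘ γ)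
    (hg.comp_continuousOn hγ.continuousOn) (fun t _ => hg0 _)
  refine ⟨θ, J', hJ', hJc', hbij, hθ, fun s hs => ?_⟩
  have hθs : HasMFDerivWithinAt 𝓘(ℝ, ℝ) 𝓘(ℝ, ℝ) θ J' s
      (ContinuousLinearMap.toSpanSingleton ℝ (g (γ (θ s)))) :=
    (hθ s hs).hasFDerivAt.hasMFDerivAt.hasMFDerivWithinAt
  have h := (hγ (θ s) (hbij.mapsTo hs)).comp s hθs hbij.mapsTo
  refine HasMFDerivWithinAt.congr_mfderiv h (ContinuousLinearMap.ext fun v : ℝ => ?_)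
  -- The chain rule for `γ ∘ θ`, with both derivatives evaluated on the time vector `v`.
  change ((v : ℝ) • g (γ (θ s))) • Y (γ (θ s)) = (v : ℝ) • X (γ (θ s))
  rw [hXY, smul_smul, smul_eq_mul]

theorem IsTimeChangeOf.trajectory_subset {g : M → ℝ} {X Y : ∀ x : M, TangentSpace (𝓡 n) x}
    (h : IsTimeChangeOf g X Y) (x : M) : trajectory Y x ⊆ trajectory X x := by
  rintro y ⟨γ, J, hJ, hJc, hγ, hx, hy⟩
  obtain ⟨θ, J', hJ', hJc', hbij, -, hγθ⟩ := h γ J hJ hJc hγ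
  -- As `θ` is onto `J`, the new curve has the same image as `γ`.
  rw [← hbij.image_eq, ← image_comp] at hx hy
  exact ⟨γ ∘ θ, J', hJ', hJc', hγθ, hx, hy⟩

end

/-- An orientable foliation with two-dimensional leaves is the Casimir foliation of a Poisson
tensor; two such tensors differ by a nowhere vanishing factor, and their Hamiltonian systems
differ by a time change and have the same trajectories. -/
theorem corollary3 {n : ℕ} {M : Type*} [TopologicalSpace M] [T2Space M]
    [SecondCountableTopology M] [ChartedSpace (EuclideanSpace ℝ (Fin n)) M]
    [IsManifold (𝓡 n) ∞ M] (F : Foliation n 2 M) (hF : F.IsOrientable) :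
    (∃ h : PoissonTensor n M, h.HasCasimirFoliation F) ∧
    ∀ h₁ h₂ : PoissonTensor n M, h₁.HasCasimirFoliation F → h₂.HasCasimirFoliation F →
      ∃ f : C^∞⟮𝓡 n, M; ℝ⟯, (∀ x, f x ≠ 0) ∧ (∀ x, h₁.form x = f x • h₂.form x) ∧
        ∀ η : ∀ x : M, Module.Dual ℝ (TangentSpace (𝓡 n) x), IsClosedOneForm η →
          IsTimeChangeOf f (h₁.hamiltonianField η) (h₂.hamiltonianField η) ∧
          IsTimeChangeOf (fun x => (f x)⁻¹) (h₂.hamiltonianField η) (h₁.hamiltonianField η) ∧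
          ∀ x, trajectory (h₁.hamiltonianField η) x = trajectory (h₂.hamiltonianField η) x := by

  refine ⟨?_, fun h₁ h₂ hF₁ hF₂ => ?_⟩
  · obtain ⟨h, hh⟩ := hF.exists_bivectorField
    exact ⟨⟨h, h.jacobi_of_range_sharp_le fun x => (hh x).le⟩, hh⟩
  · obtain ⟨f, hf0, hf⟩ := PoissonTensor.HasCasimirFoliation.exists_form_eq_smul hF hF₁ hF₂
    refine ⟨f, hf0, hf, fun η _ => ?_⟩
    have hX : ∀ x, h₁.hamiltonianField η x = f x • h₂.hamiltonianField η x := fun x => by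
      rw [← sub_eq_zero]
      refine (Module.forall_dual_apply_eq_zero_iff ℝ _).1 fun α => ?_
      simp only [PoissonTensor.hamiltonianField, map_sub, map_smul,
        BivectorField.apply_sharp, hf x, LinearMap.smul_apply, sub_self]
    have h12 := isTimeChangeOf_of_eq_smul f.contMDiff.continuous hf0 hX
    have h21 : IsTimeChangeOf (fun x => (f x)⁻¹) (h₂.hamiltonianField η) (h₁.hamiltonianField η) :=
      isTimeChangeOf_of_eq_smul (f.contMDiff.continuous.inv₀ hf0) (fun x => inv_ne_zero (hf0 x))
        fun x => by simp [hX x, smul_smul, hf0 x]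
    exact ⟨h12, h21, fun x => (h21.trajectory_subset x).antisymm (h12.trajectory_subset x)⟩
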